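/- **Brion's Formula.** Let $d\ge 0$ and let $P\subset\mathbb{R}^d$ be a convex polytope (the convex hull of finitely many points) all of whose edges have rational directions, i.e. for every edge $[v,w]$ of $P$ the vector $w-v$ is a real multiple of a vector in $\mathbb{Z}^d$; in particular, $P$ may be any polytope with vertices in $\mathbb{Q}^d$. For a vertex $v$ of $P$ let $$K_v \;=\; v+\sum_{[v,w]\text{ an edge of }P}\mathbb{R}_{\ge 0}\,(w-v)$$ be the vertex cone of $P$ at $v$. Write $x^m=x_1^{m_1}\cdots x_d^{m_d}$ for $m\in\mathbb{Z}^d$. Say that a formal Laurent series $S=\sum_{m\in\mathbb{Z}^d}a_m x^m$ with complex coefficients represents the rational function $r\in\mathbb{C}(x_1,\dots,x_d)$ if there are Laurent polynomials $f$ and $g\neq 0$ in $\mathbb{C}[x_1^{\pm1},\dots,x_d^{\pm1}]$ with $gS=f$ and $r=f/g$. Then for every vertex $v$ of $P$ the formal generating series $\sum_{m\in K_v\cap\mathbb{Z}^d}x^m$ represents exactly one rational function, denoted $\sigma_{K_v}(x)$, and the Laurent polynomial $\sigma_P(x)=\sum_{m\in P\cap\mathbb{Z}^d}x^m$ satisfies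 $$\sigma_P(x)\;=\;\sum_{v\text{ a vertex of }P}\sigma_{K_v}(x)\qquad\text{in }\mathbb{C}(x_1,\dots,x_d).$$ -/

import Mathlib

/-- A (convex) polytope in `ℝ^d`: the convex hull of finitely many points. -/
def IsPolytope {d : ℕ} (P : Set (Fin d → ℝ)) : Prop :=
  ∃ V : Finset (Fin d → ℝ), P = convexHull ℝ (V : Set (Fin d → ℝ))

/-- `[v, w]` is an edge of `P`, i.e. a one-dimensional face, with endpoints `v` and `w`. -/
def IsEdge {d : ℕ} (P : Set (Fin d → ℝ)) (v w : Fin d → ℝ) : Prop :=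
  v ≠ w ∧ v ∈ P.extremePoints ℝ ∧ w ∈ P.extremePoints ℝ ∧ IsExposed ℝ P (segment ℝ v w)

/-- A vector of `ℝ^d` has rational direction if it is a real multiple of an integer vector. -/
def HasRationalDirection {d : ℕ} (u : Fin d → ℝ) : Prop :=
  ∃ (z : Fin d → ℤ) (c : ℝ), u = c • (fun i => (z i : ℝ))

/-- The vertex cone `K_v` of `P` at `v`: apex `v`, generated by the directions of the edges of `P`
emanating from `v`; that is, `v + ∑ ℝ_{≥ 0} (w - v)` over the edges `[v, w]`. -/
def vertexCone {d : ℕ} (P : Set (Fin d → ℝ)) (v : Fin d → ℝ) : Set (Fin d → ℝ) :=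
  {x | x - v ∈ Submodule.span NNReal {u : Fin d → ℝ | ∃ w, IsEdge P v w ∧ u = w - v}}

/-- The integer points of a subset of `ℝ^d`. -/
def integerPoints {d : ℕ} (K : Set (Fin d → ℝ)) : Set (Fin d → ℤ) :=
  {m | (fun i => (m i : ℝ)) ∈ K}

theorem IsPolytope.finite_extremePoints {d : ℕ} {P : Set (Fin d → ℝ)} (hP : IsPolytope P) :
    (P.extremePoints ℝ).Finite := by
  obtain ⟨V, rfl⟩ := hP
  exact V.finite_toSet.subset extremePoints_convexHull_subset

theorem IsPolytope.finite_integerPoints {d : ℕ} {P : Set (Fin d → ℝ)} (hP : IsPolytope P) :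
    (integerPoints P).Finite := by
  obtain ⟨V, rfl⟩ := hP
  obtain ⟨R, hR⟩ := (isBounded_convexHull.2 V.finite_toSet.isBounded).exists_norm_le
  refine (Set.finite_Icc (fun _ : Fin d => ⌊-R⌋) (fun _ => ⌈R⌉)).subset ?_
  intro m hm
  have h : ∀ i, |(m i : ℝ)| ≤ R := fun i =>
    (norm_le_pi_norm (fun i => (m i : ℝ)) i).trans (hR _ hm)
  refine ⟨fun i => ?_, fun i => ?_⟩
  · have := (abs_le.1 (h i)).1
    exact_mod_cast (Int.floor_le (-R)).trans this
  · have := (abs_le.1 (h i)).2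
    exact_mod_cast this.trans (Int.le_ceil R)

/-- The finite set of vertices of a polytope. -/
noncomputable def IsPolytope.vertices {d : ℕ} {P : Set (Fin d → ℝ)} (hP : IsPolytope P) :
    Finset (Fin d → ℝ) :=
  hP.finite_extremePoints.toFinset

/-- Laurent polynomials `ℂ[x_1^{±1}, …, x_d^{±1}]`; the monomial `x^m` is
`AddMonoidAlgebra.single m 1`. -/
abbrev LaurentPoly (d : ℕ) : Type := AddMonoidAlgebra ℂ (Fin d → ℤ)

/-- The field `ℂ(x_1, …, x_d)` of rational functions, as the fraction field of the ring of Laurent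
polynomials. -/
abbrev RatFun (d : ℕ) : Type := FractionRing (LaurentPoly d)

/-- Formal Laurent series `∑ a_m x^m`, infinite in all directions, given by their coefficients. -/
abbrev FormalLaurentSeries (d : ℕ) : Type := (Fin d → ℤ) → ℂ

/-- The product of a Laurent polynomial and a formal Laurent series. -/
noncomputable def LaurentPoly.mulSeries {d : ℕ} (g : LaurentPoly d) (S : FormalLaurentSeries d) :
    FormalLaurentSeries d :=
  fun m => g.coeff.sum fun a c => c * S (m - a)

/-- A Laurent polynomial, seen as a formal Laurent series. -/
def LaurentPoly.toSeries {d : ℕ} (f : LaurentPoly d) : FormalLaurentSeries d :=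
  fun m => f.coeff m

/-- The formal Laurent series `S` represents the rational function `r`: for some Laurent
polynomials `f` and `g ≠ 0` one has `g S = f` and `r = f / g`. -/
def FormalLaurentSeries.Represents {d : ℕ} (S : FormalLaurentSeries d) (r : RatFun d) : Prop :=
  ∃ f g : LaurentPoly d, g ≠ 0 ∧ g.mulSeries S = f.toSeries ∧
    r = algebraMap (LaurentPoly d) (RatFun d) f / algebraMap (LaurentPoly d) (RatFun d) g

open Classical in
/-- The formal generating series `∑ x^m` over the integer points `m` of `K`. -/
noncomputable def generatingSeries {d : ℕ} (K : Set (Fin d → ℝ)) : FormalLaurentSeries d :=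
  fun m => if m ∈ integerPoints K then 1 else 0

open Classical in
/-- The rational generating function `σ_K` of `K`: the rational function that the formal generating
series of `K` represents (`0` if there is none). -/
noncomputable def rationalGeneratingFunction {d : ℕ} (K : Set (Fin d → ℝ)) : RatFun d :=
  if h : ∃ r, (generatingSeries K).Represents r then h.choose else 0

/-- The Laurent polynomial `σ_P = ∑ x^m` over the integer points `m` of a polytope `P`. -/
noncomputable def IsPolytope.generatingPolynomial {d : ℕ} {P : Set (Fin d → ℝ)}
    (hP : IsPolytope P) : LaurentPoly d :=
  ∑ m ∈ hP.finite_integerPoints.toFinset, AddMonoidAlgebra.single m 1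

/-!
The proof turns relations between indicator functions of convex sets into relations between
rational functions.

The convex geometry is the Euler characteristic `sum_ite_nonempty_eq_zero`: in a linear relation
between indicator functions of closed convex sets, the coefficients of the non-empty sets add up to
zero. Applied to an inclusion-exclusion over half-spaces, it gives
`sum_neg_one_pow_card_ite_exists_eq_zero`, which is used twice.

* For a cone `K` with apex `v` and integer generators `z i`, the coefficient of `x^m` in
  `∏ (1 - x^{z i})` times the series of `K` is an alternating sum that vanishes as soon as `m - v`
  is not a combination of the `z i` with coefficients in `[0, 1)`. So the product is a Laurent
  polynomial, and the series of `K` represents a rational function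
  (`exists_generatingSeries_cone_represents`).
* For a set `I` of vertices of `P`, let `Q_I` consist of the affine combinations of all vertices
  whose coefficients on `I` are non-negative (`affineCombinations`). Then `∑ (-1)^|I| [Q_I] = 0`.
  If `I` contains all vertices, `Q_I` is `P`; if it omits exactly one vertex `v`, `Q_I` is the
  vertex cone at `v`; and if it omits at least two, `Q_I` is invariant under translation by a
  non-zero integer vector `z`, so that `1 - x^z` annihilates its series and the series represents
  `0`. Reading the relation for rational functions gives Brion's formula.

The polytope enters through `span_edges_eq_span_vertices`: the cone generated by the edges at `v`
is also generated by all the differences `w - v` to other vertices. It identifies the sets `Q_I`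
with one vertex omitted as the vertex cones, and it provides the integer vector `z` although
the differences of vertices need not have rational direction.
-/

/-! ### An Euler characteristic for closed convex sets -/

/-- Near a point `x`, to its right, a compact interval looks the same as at `x`, unless `x` is its
right end. -/
theorem eventually_mem_iff_mem_and_not_isGreatest {S : Set ℝ} (hS : IsCompact S)
    (hconv : Convex ℝ S) (x : ℝ) :
    ∀ᶠ y in nhdsWithin x (Set.Ioi x), (y ∈ S ↔ x ∈ S ∧ ¬ IsGreatest S x) := by
  by_cases hx : x ∈ S
  · by_cases hg : IsGreatest S x
    · filter_upwards [self_mem_nhdsWithin] with y hy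
      have hyS : y ∉ S := fun h => (hg.2 h).not_gt hy
      simp [hyS, hg]
    · obtain ⟨z, hz, hxz⟩ : ∃ z ∈ S, x < z := by
        by_contra! h
        exact hg ⟨hx, h⟩
      filter_upwards [Ioo_mem_nhdsGT hxz] with y hy
      have hyS : y ∈ S := hconv.ordConnected.out hx hz ⟨hy.1.le, hy.2.le⟩
      simp [hyS, hg, hx]
  · filter_upwards [nhdsWithin_le_nhds (hS.isClosed.isOpen_compl.mem_nhds hx)] with y hy
    have hyS : y ∉ S := hy
    simp [hyS, hx]

open Classical in
/-- The one-dimensional case. Comparing the relation at `x` and slightly to the right of `x` shows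
that the coefficients of the intervals with right end `x` add up to zero. -/
theorem sum_ite_nonempty_eq_zero_of_real {ι M : Type*} [Fintype ι] [AddCommGroup M] (c : ι → M)
    (S : ι → Set ℝ) (hS : ∀ i, IsCompact (S i)) (hconv : ∀ i, Convex ℝ (S i))
    (h : ∀ x, ∑ i, (if x ∈ S i then c i else 0) = 0) :
    ∑ i, (if (S i).Nonempty then c i else 0) = 0 := by
  have hend : ∀ x, ∑ i, (if IsGreatest (S i) x then c i else 0) = 0 := by
    intro x
    obtain ⟨y, hy⟩ := (Filter.eventually_all.2 fun i =>
      eventually_mem_iff_mem_and_not_isGreatest (hS i) (hconv i) x).exists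
    have hdiff := congrArg₂ (· - ·) (h x) (h y)
    rw [← Finset.sum_sub_distrib, sub_zero] at hdiff
    refine Eq.trans (Finset.sum_congr rfl fun i _ => ?_) hdiff
    by_cases hg : IsGreatest (S i) x
    · simp [hy i, hg, hg.1]
    · by_cases hx : x ∈ S i <;> simp [hy i, hg, hx]
  have hmax : ∀ i, (S i).Nonempty → IsGreatest (S i) (sSup (S i)) := fun i hi =>
    (hS i).isGreatest_sSup hi
  calc ∑ i, (if (S i).Nonempty then c i else 0)
      = ∑ i, ∑ x ∈ Finset.univ.image (fun i => sSup (S i)),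
          (if IsGreatest (S i) x then c i else 0) := by
        refine Finset.sum_congr rfl fun i _ => ?_
        split_ifs with hi
        · rw [Finset.sum_eq_single_of_mem (sSup (S i))
            (Finset.mem_image_of_mem (fun i => sSup (S i)) (Finset.mem_univ i))
            fun x _ hx => if_neg fun hg : IsGreatest (S i) x => hx (hg.unique (hmax i hi)),
            if_pos (hmax i hi)]
        · exact (Finset.sum_eq_zero fun x _ => if_neg fun hg => hi ⟨x, hg.1⟩).symm
    _ = 0 := by
        rw [Finset.sum_comm]
        exact Finset.sum_eq_zero fun x _ => hend x

open Classical in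
/-- The compact case, by induction on a set `s` of coordinates that suffices to tell apart the
points in question: the slices `x k = t` satisfy the claim by induction, so the projections
to the coordinate `k` satisfy the hypothesis of the one-dimensional case. -/
theorem sum_ite_nonempty_eq_zero_of_isCompact {ι κ M : Type*} [Fintype ι] [AddCommGroup M]
    (c : ι → M) (s : Finset κ) (A : ι → Set (κ → ℝ)) (hA : ∀ i, IsCompact (A i))
    (hconv : ∀ i, Convex ℝ (A i))
    (hsep : ∀ i j, ∀ x ∈ A i, ∀ y ∈ A j, (∀ k ∈ s, x k = y k) → x = y)
    (h : ∀ x, ∑ i, (if x ∈ A i then c i else 0) = 0) :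
    ∑ i, (if (A i).Nonempty then c i else 0) = 0 := by
  induction s using Finset.induction_on generalizing A with
  | empty =>
    by_cases hne : ∃ i, (A i).Nonempty
    · obtain ⟨i, x, hx⟩ := hne
      refine Eq.trans (Finset.sum_congr rfl fun j _ => ?_) (h x)
      have : (A j).Nonempty ↔ x ∈ A j :=
        ⟨fun ⟨y, hy⟩ => hsep i j x hx y hy (by simp) ▸ hy, fun hy => ⟨x, hy⟩⟩
      simp [this]
    · push Not at hne
      simp [hne]
  | insert k s _ ih =>
    have hproj : ∀ t : ℝ, ∑ i, (if t ∈ (fun x : κ → ℝ => x k) '' A i then c i else 0) = 0 := by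
      intro t
      have hslice := ih (fun i => A i ∩ {x | x k = t})
        (fun i => (hA i).inter_right (isClosed_eq (continuous_apply k) continuous_const))
        (fun i => (hconv i).inter
          (convex_hyperplane (LinearMap.proj (R := ℝ) (φ := fun _ : κ => ℝ) k).isLinear t))
        (fun i j x hx y hy hxy => hsep i j x hx.1 y hy.1 fun l hl => by
          rcases Finset.mem_insert.1 hl with rfl | hl
          · exact hx.2.trans hy.2.symm
          · exact hxy l hl)
        (fun x => by
          by_cases hx : x k = t
          · simpa [hx] using h x
          · simp [hx])
      exact hslice
    have := sum_ite_nonempty_eq_zero_of_real c (fun i => (fun x : κ → ℝ => x k) '' A i)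
      (fun i => (hA i).image (continuous_apply k))
      (fun i => (hconv i).is_linear_image
        (LinearMap.proj (R := ℝ) (φ := fun _ : κ => ℝ) k).isLinear) hproj
    simpa using this

open Classical in
/-- The Euler characteristic: a linear relation between the indicator functions of closed convex
sets persists when the indicator function of every non-empty set is replaced by `1`. -/
theorem sum_ite_nonempty_eq_zero {ι κ M : Type*} [Fintype ι] [Fintype κ] [AddCommGroup M]
    (c : ι → M) (A : ι → Set (κ → ℝ)) (hA : ∀ i, IsClosed (A i)) (hconv : ∀ i, Convex ℝ (A i))
    (h : ∀ x, ∑ i, (if x ∈ A i then c i else 0) = 0) :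
    ∑ i, (if (A i).Nonempty then c i else 0) = 0 := by
  -- A ball that meets all the non-empty sets reduces the claim to the compact case.
  obtain ⟨R, hR⟩ : ∃ R : ℝ, ∀ i, (A i).Nonempty →
      (A i ∩ Metric.closedBall (0 : κ → ℝ) R).Nonempty := by
    have hi : ∀ i, ∃ R : ℝ, ∀ R' ≥ R, (A i).Nonempty →
        (A i ∩ Metric.closedBall (0 : κ → ℝ) R').Nonempty := by
      intro i
      by_cases hne : (A i).Nonempty
      · obtain ⟨x, hx⟩ := hne
        exact ⟨‖x‖, fun R' hR' _ => ⟨x, hx, by simpa using hR'⟩⟩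
      · exact ⟨0, fun _ _ h => absurd h hne⟩
    choose r hr using hi
    exact ⟨∑ i, |r i|, fun i => hr i _ ((le_abs_self _).trans
      (Finset.single_le_sum (fun j _ => abs_nonneg (r j)) (Finset.mem_univ i)))⟩
  have := sum_ite_nonempty_eq_zero_of_isCompact c Finset.univ
    (fun i => A i ∩ Metric.closedBall (0 : κ → ℝ) R)
    (fun i => (isCompact_closedBall _ _).inter_left (hA i))
    (fun i => (hconv i).inter (convex_closedBall _ _))
    (fun i j x _ y _ hxy => funext fun k => hxy k (Finset.mem_univ k))
    (fun x => by
      by_cases hx : x ∈ Metric.closedBall (0 : κ → ℝ) R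
      · simpa only [Set.mem_inter_iff, hx, and_true] using h x
      · simp only [Set.mem_inter_iff, hx, and_false, if_false, Finset.sum_const_zero])
  refine Eq.trans (Finset.sum_congr rfl fun i _ => ?_) this
  have : (A i).Nonempty ↔ (A i ∩ Metric.closedBall (0 : κ → ℝ) R).Nonempty :=
    ⟨hR i, fun h => h.mono Set.inter_subset_left⟩
  simp [this]

open Classical in
/-- Inclusion-exclusion for the half-spaces `a i ≤ x i`, after taking Euler characteristics: if the
complements of these half-spaces have no common point in `A`, then the alternating sum over the
intersections that meet `A` is zero. -/
theorem sum_neg_one_pow_card_ite_exists_eq_zero {κ : Type*} [Fintype κ] {A : Set (κ → ℝ)}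
    (hA : IsClosed A) (hconv : Convex ℝ A) (a : κ → ℝ) (h : ¬ ∃ x ∈ A, ∀ i, x i < a i) :
    ∑ I : Finset κ, (if ∃ x ∈ A, ∀ i ∈ I, a i ≤ x i then (-1 : ℂ) ^ I.card else 0) = 0 := by
  have hhalf : ∀ I : Finset κ, {x : κ → ℝ | ∀ i ∈ I, a i ≤ x i} =
      ⋂ i ∈ I, {x : κ → ℝ | a i ≤ x i} := fun I => by ext; simp
  refine Eq.trans ?_ (sum_ite_nonempty_eq_zero (fun I : Finset κ => (-1 : ℂ) ^ I.card)
    (fun I => A ∩ {x | ∀ i ∈ I, a i ≤ x i}) (fun I => ?_) (fun I => ?_) fun x => ?_)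
  · rfl
  · rw [hhalf]
    exact hA.inter (isClosed_biInter fun i _ => isClosed_le continuous_const (continuous_apply i))
  · rw [hhalf]
    exact hconv.inter (convex_iInter₂ fun i _ => convex_halfSpace_ge
      (LinearMap.proj (R := ℝ) (φ := fun _ : κ => ℝ) i).isLinear (a i))
  · by_cases hx : x ∈ A
    · have hne : (Finset.univ.filter fun i => a i ≤ x i) ≠ ∅ := by
        intro he
        refine h ⟨x, hx, fun i => lt_of_not_ge fun hi => ?_⟩
        exact Finset.notMem_empty i (he ▸ Finset.mem_filter.2 ⟨Finset.mem_univ i, hi⟩)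
      have hsum := Finset.sum_powerset_neg_one_pow_card (x := Finset.univ.filter fun i => a i ≤ x i)
      rw [if_neg hne] at hsum
      have hfilter : (Finset.univ.filter fun I : Finset κ =>
          x ∈ A ∩ {x | ∀ i ∈ I, a i ≤ x i}) =
          (Finset.univ.filter fun i => a i ≤ x i).powerset := by
        ext I
        simp [hx, Finset.subset_iff]
      rw [← hfilter, Finset.sum_filter] at hsum
      exact_mod_cast congrArg (Int.cast : ℤ → ℂ) hsum
    · simp [hx]

/-! ### Formal Laurent series and the rational functions they represent -/

section Series

variable {d : ℕ}

/-- Multiplication by the monomial `x^a`, as a linear endomorphism of the formal Laurent series. -/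
def monomialShift (a : Fin d → ℤ) : Module.End ℂ (FormalLaurentSeries d) where
  toFun S := fun m => S (m - a)
  map_add' _ _ := rfl
  map_smul' _ _ := rfl

/-- The formal Laurent series form a module over the Laurent polynomials. -/
noncomputable def seriesAction (d : ℕ) :
    LaurentPoly d →ₐ[ℂ] Module.End ℂ (FormalLaurentSeries d) :=
  AddMonoidAlgebra.lift ℂ (Module.End ℂ (FormalLaurentSeries d)) (Fin d → ℤ)
    { toFun := fun a => monomialShift a.toAdd
      map_one' := by ext S m; simp [monomialShift]
      map_mul' := fun a b => by ext S m; simp [monomialShift, sub_sub] }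

theorem seriesAction_apply (g : LaurentPoly d) (S : FormalLaurentSeries d) :
    seriesAction d g S = g.mulSeries S := by
  ext m
  simp [seriesAction, AddMonoidAlgebra.lift_apply, LaurentPoly.mulSeries, Finsupp.sum,
    monomialShift]

theorem seriesAction_single_apply (a : Fin d → ℤ) (S : FormalLaurentSeries d) (m : Fin d → ℤ) :
    seriesAction d (AddMonoidAlgebra.single a 1) S m = S (m - a) := by
  simp [seriesAction, monomialShift]

theorem toSeries_injective : Function.Injective (LaurentPoly.toSeries (d := d)) := by
  intro f g h
  ext m
  exact congrFun h m

theorem seriesAction_toSeries (g f : LaurentPoly d) :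
    seriesAction d g f.toSeries = (g * f).toSeries := by
  induction g using AddMonoidAlgebra.induction_linear with
  | zero => ext m; simp [LaurentPoly.toSeries]
  | add g₁ g₂ h₁ h₂ =>
    ext m
    simp [add_mul, h₁, h₂, LaurentPoly.toSeries]
  | single a c =>
    ext m
    have := AddMonoidAlgebra.coeff_single_mul_eq_mul_coeff (m := a) (m₁ := m) (r := c) (x := f)
      (m - a) (fun b _ => by rw [eq_sub_iff_add_eq, add_comm])
    simp [seriesAction, monomialShift, LaurentPoly.toSeries, this]

theorem FormalLaurentSeries.represents_iff {S : FormalLaurentSeries d} {r : RatFun d} :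
    S.Represents r ↔ ∃ f g : LaurentPoly d, g ≠ 0 ∧ seriesAction d g S = f.toSeries ∧
      r = algebraMap (LaurentPoly d) (RatFun d) f / algebraMap (LaurentPoly d) (RatFun d) g := by
  simp_rw [seriesAction_apply]
  rfl

theorem algebraMap_ratFun_ne_zero {g : LaurentPoly d} (hg : g ≠ 0) :
    algebraMap (LaurentPoly d) (RatFun d) g ≠ 0 :=
  (map_ne_zero_iff _ (IsFractionRing.injective (LaurentPoly d) (RatFun d))).2 hg

theorem FormalLaurentSeries.Represents.unique {S : FormalLaurentSeries d} {r r' : RatFun d}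
    (h : S.Represents r) (h' : S.Represents r') : r = r' := by
  obtain ⟨f, g, hg, hS, rfl⟩ := represents_iff.1 h
  obtain ⟨f', g', hg', hS', rfl⟩ := represents_iff.1 h'
  have hcross : g' * f = g * f' := by
    apply toSeries_injective
    rw [← seriesAction_toSeries, ← seriesAction_toSeries, ← hS, ← hS', ← Module.End.mul_apply,
      ← Module.End.mul_apply, ← map_mul, ← map_mul, mul_comm]
  rw [div_eq_div_iff (algebraMap_ratFun_ne_zero hg) (algebraMap_ratFun_ne_zero hg'), ← map_mul,
    ← map_mul, mul_comm f, hcross, mul_comm g]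

theorem FormalLaurentSeries.Represents.add {S S' : FormalLaurentSeries d} {r r' : RatFun d}
    (h : S.Represents r) (h' : S'.Represents r') : (S + S').Represents (r + r') := by
  obtain ⟨f, g, hg, hS, rfl⟩ := represents_iff.1 h
  obtain ⟨f', g', hg', hS', rfl⟩ := represents_iff.1 h'
  refine represents_iff.2 ⟨g' * f + g * f', g * g', mul_ne_zero hg hg', ?_, ?_⟩
  · have hadd : (g' * f + g * f').toSeries = (g' * f).toSeries + (g * f').toSeries := by
      ext m; simp [LaurentPoly.toSeries]
    rw [hadd, map_add, ← seriesAction_toSeries, ← seriesAction_toSeries, ← hS, ← hS',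
      ← Module.End.mul_apply, ← Module.End.mul_apply, ← map_mul, ← map_mul, mul_comm g']
  · have hg₀ := algebraMap_ratFun_ne_zero hg
    have hg₀' := algebraMap_ratFun_ne_zero hg'
    simp only [map_add, map_mul]
    field_simp

theorem FormalLaurentSeries.Represents.neg {S : FormalLaurentSeries d} {r : RatFun d}
    (h : S.Represents r) : (-S).Represents (-r) := by
  obtain ⟨f, g, hg, hS, rfl⟩ := represents_iff.1 h
  refine represents_iff.2 ⟨-f, g, hg, ?_, by rw [map_neg]; exact (neg_div _ _).symm⟩
  rw [map_neg, hS]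
  ext m
  simp [LaurentPoly.toSeries]

theorem represents_toSeries (f : LaurentPoly d) :
    f.toSeries.Represents (algebraMap (LaurentPoly d) (RatFun d) f) :=
  FormalLaurentSeries.represents_iff.2 ⟨f, 1, one_ne_zero, by simp, by simp⟩

theorem represents_zero : (0 : FormalLaurentSeries d).Represents 0 := by
  have h := represents_toSeries (0 : LaurentPoly d)
  rwa [map_zero, show (0 : LaurentPoly d).toSeries = 0 from rfl] at h

theorem represents_sum {ι : Type*} (s : Finset ι) {S : ι → FormalLaurentSeries d}
    {r : ι → RatFun d} (h : ∀ i ∈ s, (S i).Represents (r i)) :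
    (∑ i ∈ s, S i).Represents (∑ i ∈ s, r i) := by
  induction s using Finset.cons_induction with
  | empty => simpa using represents_zero
  | cons i s hi ih =>
    rw [Finset.sum_cons, Finset.sum_cons]
    exact (h i (Finset.mem_cons_self i s)).add
      (ih fun j hj => h j (Finset.mem_cons_of_mem hj))

theorem represents_neg_one_pow_smul {S : FormalLaurentSeries d} {r : RatFun d}
    (h : S.Represents r) (n : ℕ) : (((-1 : ℂ) ^ n) • S).Represents ((-1) ^ n * r) := by
  rcases neg_one_pow_eq_or ℂ n with hn | hn
  · have hn' : (-1 : RatFun d) ^ n = 1 := by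
      simpa using congrArg (algebraMap ℂ (RatFun d)) hn
    rw [hn, hn', one_smul, one_mul]
    exact h
  · have hn' : (-1 : RatFun d) ^ n = -1 := by
      simpa using congrArg (algebraMap ℂ (RatFun d)) hn
    rw [hn, hn', neg_one_smul, neg_one_mul]
    exact h.neg

theorem one_sub_single_ne_zero {z : Fin d → ℤ} (hz : z ≠ 0) :
    (1 - AddMonoidAlgebra.single z 1 : LaurentPoly d) ≠ 0 := by
  intro h
  have := congrArg (fun f : LaurentPoly d => f.coeff 0) h
  simp [AddMonoidAlgebra.one_def, hz] at this

/-- The series of a set that is invariant under a non-zero integer translation `z` is annihilated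
by `1 - x^z`, so it represents `0`. -/
theorem represents_zero_of_invariant {S : FormalLaurentSeries d} {z : Fin d → ℤ} (hz : z ≠ 0)
    (hS : ∀ m, S (m - z) = S m) : S.Represents 0 := by
  refine FormalLaurentSeries.represents_iff.2 ⟨0, _, one_sub_single_ne_zero hz, ?_, by simp⟩
  ext m
  rw [map_sub, LinearMap.sub_apply, Pi.sub_apply, seriesAction_single_apply, hS]
  simp [LaurentPoly.toSeries]

/-- A series that a non-zero Laurent polynomial multiplies into one with finite support represents
a rational function. -/
theorem exists_represents_of_finite_support {S : FormalLaurentSeries d} {g : LaurentPoly d}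
    (hg : g ≠ 0) (h : (Function.support (seriesAction d g S)).Finite) : ∃ r, S.Represents r :=
  ⟨_, FormalLaurentSeries.represents_iff.2
    ⟨.ofCoeff (Finsupp.ofSupportFinite _ h), g, hg, rfl, rfl⟩⟩

theorem generatingSeries_represents_rationalGeneratingFunction {K : Set (Fin d → ℝ)}
    (h : ∃ r, (generatingSeries K).Represents r) :
    (generatingSeries K).Represents (rationalGeneratingFunction K) := by
  rw [rationalGeneratingFunction, dif_pos h]
  exact h.choose_spec

theorem IsPolytope.toSeries_generatingPolynomial {P : Set (Fin d → ℝ)} (hP : IsPolytope P) :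
    hP.generatingPolynomial.toSeries = generatingSeries P := by
  classical
  ext m
  simp [LaurentPoly.toSeries, generatingPolynomial, generatingSeries, Finsupp.single_apply]

/-- The product of the factors `1 - x^{z i}` acts on series by an alternating sum of shifts. -/
theorem seriesAction_prod_one_sub_single {κ : Type*} [Fintype κ] (z : κ → Fin d → ℤ)
    (S : FormalLaurentSeries d) (m : Fin d → ℤ) :
    seriesAction d (∏ i, (1 - AddMonoidAlgebra.single (z i) 1)) S m =
      ∑ I : Finset κ, (-1 : ℂ) ^ I.card * S (m - ∑ i ∈ I, z i) := by
  classical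
  have hsingle : ∀ I : Finset κ, ∏ i ∈ I, (-AddMonoidAlgebra.single (z i) 1 : LaurentPoly d) =
      (-1 : ℂ) ^ I.card • AddMonoidAlgebra.single (∑ i ∈ I, z i) 1 := by
    intro I
    induction I using Finset.induction_on with
    | empty => simp [AddMonoidAlgebra.one_def]
    | insert i I hi ih =>
      rw [Finset.prod_insert hi, ih, Finset.sum_insert hi, Finset.card_insert_of_notMem hi]
      simp [AddMonoidAlgebra.single_mul_single, pow_succ]
  simp_rw [sub_eq_add_neg, Finset.prod_one_add, hsingle, map_sum, map_smul, LinearMap.sum_apply,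
    Finset.sum_apply, LinearMap.smul_apply, Pi.smul_apply, seriesAction_single_apply, smul_eq_mul,
    Finset.powerset_univ, ← sub_eq_add_neg]

end Series

/-! ### Rationality of cones -/

section Cones

variable {d : ℕ}

/-- The direction may be taken positive: the sign of the real factor moves to the integer
vector. -/
theorem HasRationalDirection.exists_pos_smul {u : Fin d → ℝ} (h : HasRationalDirection u)
    (hu : u ≠ 0) : ∃ (z : Fin d → ℤ) (c : NNReal), z ≠ 0 ∧ c ≠ 0 ∧
      u = c • (fun i => (z i : ℝ)) := by
  obtain ⟨z, c, rfl⟩ := h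
  have hz : z ≠ 0 := by
    rintro rfl
    exact hu (by ext; simp)
  rcases lt_trichotomy c 0 with hc | rfl | hc
  · refine ⟨-z, (-c).toNNReal, neg_ne_zero.2 hz, by simpa using hc, ?_⟩
    ext i
    simp [NNReal.smul_def, hc.le]
  · simp at hu
  · refine ⟨z, c.toNNReal, hz, by simpa using hc, ?_⟩
    ext i
    simp [NNReal.smul_def, hc.le]

theorem finite_integerPoints_of_isBounded {K : Set (Fin d → ℝ)} (hK : Bornology.IsBounded K) :
    (integerPoints K).Finite := by
  obtain ⟨R, hR⟩ := hK.exists_norm_le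
  refine (Set.finite_Icc (fun _ : Fin d => ⌊-R⌋) (fun _ => ⌈R⌉)).subset fun m hm => ?_
  have h : ∀ i, |(m i : ℝ)| ≤ R := fun i =>
    (norm_le_pi_norm (fun i => (m i : ℝ)) i).trans (hR _ hm)
  refine ⟨fun i => ?_, fun i => ?_⟩
  · exact_mod_cast (Int.floor_le (-R)).trans (abs_le.1 (h i)).1
  · exact_mod_cast (abs_le.1 (h i)).2.trans (Int.le_ceil R)

theorem mem_span_nnreal_range_iff {E κ : Type*} [AddCommGroup E] [Module ℝ E] [Fintype κ]
    {u : κ → E} {x : E} :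
    x ∈ Submodule.span NNReal (Set.range u) ↔ ∃ c : κ → ℝ, (∀ i, 0 ≤ c i) ∧ ∑ i, c i • u i = x := by
  rw [Submodule.mem_span_range_iff_exists_fun]
  constructor
  · rintro ⟨c, rfl⟩
    exact ⟨fun i => c i, fun i => (c i).2, rfl⟩
  · rintro ⟨c, hc, rfl⟩
    exact ⟨fun i => ⟨c i, hc i⟩, rfl⟩

/-- The generating series of a shifted cone with integer generators `z i` represents a rational
function with denominator `∏ (1 - x^{z i})`. The coefficient of `x^m` in the numerator is an
alternating sum over the sets `I` of generators for which `m - v` is a non-negative combination of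
all generators with coefficients at least `1` on `I`. By the Euler characteristic this sum is zero
unless `m - v` is a combination with coefficients in `[0, 1)`, and there are only finitely many such
`m`. -/
theorem exists_generatingSeries_cone_represents {κ : Type*} [Fintype κ] {z : κ → Fin d → ℤ}
    (hz : ∀ i, z i ≠ 0) (v : Fin d → ℝ) :
    ∃ r, (generatingSeries {x : Fin d → ℝ |
      x - v ∈ Submodule.span NNReal (Set.range fun i j => (z i j : ℝ))}).Represents r := by
  classical
  have hbox : IsCompact ((fun c : κ → ℝ => v + ∑ i, c i • fun j => (z i j : ℝ)) ''
      Set.Icc 0 1) := isCompact_Icc.image (by fun_prop)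
  refine exists_represents_of_finite_support
    (g := ∏ i, (1 - AddMonoidAlgebra.single (z i) 1))
    (Finset.prod_ne_zero_iff.2 fun i _ => one_sub_single_ne_zero (hz i))
    ((finite_integerPoints_of_isBounded hbox.isBounded).subset fun m hm => ?_)
  by_contra hout
  refine hm ?_
  rw [seriesAction_prod_one_sub_single]
  let L : (κ → ℝ) →ₗ[ℝ] Fin d → ℝ :=
    ∑ i, (LinearMap.proj (R := ℝ) (φ := fun _ : κ => ℝ) i).smulRight fun j => (z i j : ℝ)
  have hL : ∀ c, L c = ∑ i, c i • fun j => (z i j : ℝ) := fun c => by simp [L]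
  let A : Set (κ → ℝ) := Set.Ici 0 ∩ L ⁻¹' {(fun j => (m j : ℝ)) - v}
  have hA : IsClosed A := isClosed_Ici.inter
    (isClosed_singleton.preimage L.continuous_of_finiteDimensional)
  have hconv : Convex ℝ A := (convex_Ici 0).inter ((convex_singleton _).linear_preimage L)
  refine Eq.trans (Finset.sum_congr rfl fun I _ => ?_)
    (sum_neg_one_pow_card_ite_exists_eq_zero hA hconv (fun _ => 1) ?_)
  · have hiff : (m - ∑ i ∈ I, z i) ∈ integerPoints {x : Fin d → ℝ |
        x - v ∈ Submodule.span NNReal (Set.range fun i j => (z i j : ℝ))} ↔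
        ∃ c ∈ A, ∀ i ∈ I, 1 ≤ c i := by
      have hind : ∑ i, (if i ∈ I then (1 : ℝ) else 0) • (fun j => (z i j : ℝ)) =
          ∑ i ∈ I, fun j => (z i j : ℝ) := by
        simp
      have hcast : (fun j => ((m - ∑ i ∈ I, z i) j : ℝ)) =
          (fun j => (m j : ℝ)) - ∑ i ∈ I, fun j => (z i j : ℝ) := by
        ext j
        simp
      simp only [integerPoints, Set.mem_ofPred_eq, mem_span_nnreal_range_iff, hcast]
      constructor
      · rintro ⟨c, hc, hcm⟩
        refine ⟨fun i => c i + if i ∈ I then 1 else 0, ⟨fun i => ?_, ?_⟩, fun i hi => ?_⟩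
        · have : (0 : ℝ) ≤ if i ∈ I then 1 else 0 := by split_ifs <;> norm_num
          exact add_nonneg (hc i) this
        · simp only [Set.mem_preimage, Set.mem_singleton_iff, hL, add_smul,
            Finset.sum_add_distrib, hcm, hind]
          abel
        · simpa [hi] using hc i
      · rintro ⟨c, ⟨hc, hcm⟩, hcI⟩
        refine ⟨fun i => c i - if i ∈ I then 1 else 0, fun i => ?_, ?_⟩
        · by_cases hi : i ∈ I
          · simpa [hi] using hcI i hi
          · simpa [hi] using hc i
        · simp only [Set.mem_preimage, Set.mem_singleton_iff, hL] at hcm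
          simp only [sub_smul, Finset.sum_sub_distrib, hcm, hind]
          abel
    simp [generatingSeries, hiff]
  · rintro ⟨c, ⟨hc, hcm⟩, hc1⟩
    refine hout ⟨c, ⟨hc, fun i => (hc1 i).le⟩, ?_⟩
    simp only [Set.mem_preimage, Set.mem_singleton_iff, hL] at hcm
    simp only [hcm]
    abel

theorem exists_generatingSeries_vertexCone_represents {P : Set (Fin d → ℝ)} (hP : IsPolytope P)
    {v : Fin d → ℝ} (hrat : ∀ w, IsEdge P v w → HasRationalDirection (w - v)) :
    ∃ r, (generatingSeries (vertexCone P v)).Represents r := by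
  have hfin : Finite {w // IsEdge P v w} :=
    (hP.finite_extremePoints.subset fun w (hw : IsEdge P v w) => hw.2.2.1).to_subtype
  have := Fintype.ofFinite {w // IsEdge P v w}
  have hpos := fun e : {w // IsEdge P v w} =>
    (hrat e e.2).exists_pos_smul (sub_ne_zero.2 e.2.1.symm)
  choose z c hz hc hu using hpos
  have hspan : Submodule.span NNReal {u : Fin d → ℝ | ∃ w, IsEdge P v w ∧ u = w - v} =
      Submodule.span NNReal (Set.range fun e j => (z e j : ℝ)) := by
    refine le_antisymm (Submodule.span_le.2 ?_) (Submodule.span_le.2 ?_)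
    · rintro _ ⟨w, hw, rfl⟩
      exact (hu ⟨w, hw⟩) ▸ Submodule.smul_mem _ _ (Submodule.subset_span ⟨_, rfl⟩)
    · rintro _ ⟨e, rfl⟩
      have := Submodule.smul_mem (Submodule.span NNReal
        {u : Fin d → ℝ | ∃ w, IsEdge P v w ∧ u = w - v}) (c e)⁻¹
        (Submodule.subset_span ⟨e, e.2, rfl⟩)
      rwa [hu e, inv_smul_smul₀ (hc e)] at this
  simpa only [vertexCone, hspan] using exists_generatingSeries_cone_represents hz v

end Cones

/-! ### The edges at a vertex generate its cone -/

section Edges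

variable {d : ℕ}

theorem IsPolytope.convexHull_extremePoints {P : Set (Fin d → ℝ)} (hP : IsPolytope P) :
    convexHull ℝ (P.extremePoints ℝ) = P := by
  have hfin := hP.finite_extremePoints
  obtain ⟨V, rfl⟩ := hP
  rw [← (hfin.isClosed_convexHull ℝ).closure_eq]
  exact closure_convexHull_extremePoints (V.finite_toSet.isCompact_convexHull ℝ)
    (convex_convexHull ℝ _)

/-- A linear functional that is positive on a set of generators is positive on the cone, except at
its apex. -/
theorem nonneg_and_eq_zero_of_mem_span_nnreal {E : Type*} [AddCommGroup E] [Module ℝ E] {G : Set E}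
    {φ : E →ₗ[ℝ] ℝ} (hpos : ∀ g ∈ G, 0 < φ g) {y : E} (hy : y ∈ Submodule.span NNReal G) :
    0 ≤ φ y ∧ (φ y = 0 → y = 0) := by
  induction hy using Submodule.span_induction with
  | mem g hg => exact ⟨(hpos g hg).le, fun h => absurd h (hpos g hg).ne'⟩
  | zero => exact ⟨(map_zero φ).ge, fun _ => rfl⟩
  | add x y _ _ hx hy =>
    refine ⟨map_add φ x y ▸ add_nonneg hx.1 hy.1, fun h => ?_⟩
    rw [map_add, add_eq_zero_iff_of_nonneg hx.1 hy.1] at h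
    rw [hx.2 h.1, hy.2 h.2, add_zero]
  | smul a x _ hx =>
    have ha : φ (a • x) = a * φ x := map_smul φ (a : ℝ) x
    refine ⟨ha ▸ mul_nonneg a.2 hx.1, fun h => ?_⟩
    rw [ha, mul_eq_zero] at h
    rcases h with h | h
    · rw [NNReal.coe_eq_zero.1 h, zero_smul]
    · rw [hx.2 h, smul_zero]

/-- A generator `g` of a pointed cone that is not in the cone of the other generators spans an
exposed ray. The functional separates the line of `g` from the convex hull of the others. -/
theorem exists_dual_eq_zero_and_pos {G : Set (Fin d → ℝ)} (hG : G.Finite)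
    {l : StrongDual ℝ (Fin d → ℝ)} (hl : ∀ x ∈ G, 0 < l x) {g : Fin d → ℝ} (hlg : 0 < l g)
    (hg : g ∉ Submodule.span NNReal G) :
    ∃ φ : StrongDual ℝ (Fin d → ℝ), φ g = 0 ∧ ∀ x ∈ G, 0 < φ x := by
  have hdisj : Disjoint (Submodule.span ℝ {g} : Set (Fin d → ℝ)) (convexHull ℝ G) := by
    refine Set.disjoint_left.2 fun x hx hxG => ?_
    obtain ⟨t, rfl⟩ := Submodule.mem_span_singleton.1 hx
    have hlt : 0 < l (t • g) :=
      convexHull_min (t := {x | 0 < l x}) hl (convex_halfSpace_gt l.toLinearMap.isLinear 0) hxG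
    have ht : 0 < t := by
      rw [map_smul, smul_eq_mul] at hlt
      exact pos_of_mul_pos_left hlt hlg.le
    have hmem : t • g ∈ Submodule.span NNReal G := by
      refine convexHull_min (t := (Submodule.span NNReal G : Set (Fin d → ℝ)))
        Submodule.subset_span (fun x hx y hy a b ha hb _ => ?_) hxG
      exact add_mem (Submodule.smul_mem _ (⟨a, ha⟩ : NNReal) hx)
        (Submodule.smul_mem _ (⟨b, hb⟩ : NNReal) hy)
    refine hg ?_
    lift t to NNReal using ht.le
    have ht0 : t ≠ 0 := by exact_mod_cast ht.ne'
    have := Submodule.smul_mem _ t⁻¹ hmem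
    rwa [show (t : ℝ) • g = t • g from rfl, inv_smul_smul₀ ht0] at this
  obtain ⟨φ, a, b, hφa, hab, hφb⟩ := geometric_hahn_banach_closed_compact
    (Submodule.convex (Submodule.span ℝ {g}))
    (Submodule.closed_of_finiteDimensional (Submodule.span ℝ {g})) (convex_convexHull ℝ G)
    (hG.isCompact_convexHull ℝ) hdisj
  have ha : 0 < a := by simpa using hφa 0 (zero_mem _)
  refine ⟨φ, ?_, fun x hx => ha.trans (hab.trans (hφb x (subset_convexHull ℝ G hx)))⟩
  by_contra hne
  have := hφa ((a / φ g) • g) (Submodule.smul_mem _ _ (Submodule.mem_span_singleton_self g))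
  rw [map_smul, smul_eq_mul, div_mul_cancel₀ _ hne] at this
  exact this.false

/-- A vertex `w` is joined to `v` by an edge if `w - v` spans an exposed ray of the cone of `v`. -/
theorem isEdge_of_dual {P : Set (Fin d → ℝ)} (hP : IsPolytope P) {v w : Fin d → ℝ}
    (hv : v ∈ P.extremePoints ℝ) (hw : w ∈ P.extremePoints ℝ) (hvw : v ≠ w)
    {φ : StrongDual ℝ (Fin d → ℝ)} (hφw : φ w = φ v)
    (hφ : ∀ x ∈ P.extremePoints ℝ, φ v ≤ φ x ∧
      (φ x = φ v → ∃ t : ℝ, 0 ≤ t ∧ x - v = t • (w - v))) : IsEdge P v w := by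
  refine ⟨hvw, hv, hw, fun _ => ⟨-φ, ?_⟩⟩
  have hconv : Convex ℝ {x | φ v ≤ φ x ∧ (φ x = φ v → x ∈ segment ℝ v w)} := by
    refine convex_iff_forall_pos.2 fun x hx y hy a b ha hb hab => ?_
    have hval : φ (a • x + b • y) - φ v = a * (φ x - φ v) + b * (φ y - φ v) := by
      simp only [map_add, map_smul, smul_eq_mul]
      linear_combination φ v * hab
    have hxa := mul_nonneg ha.le (sub_nonneg.2 hx.1)
    have hyb := mul_nonneg hb.le (sub_nonneg.2 hy.1)
    refine ⟨sub_nonneg.1 (hval ▸ add_nonneg hxa hyb), fun h => ?_⟩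
    rw [h, sub_self, eq_comm, add_eq_zero_iff_of_nonneg hxa hyb, mul_eq_zero_iff_left ha.ne',
      mul_eq_zero_iff_left hb.ne', sub_eq_zero, sub_eq_zero] at hval
    exact convex_segment v w (hx.2 hval.1) (hy.2 hval.2) ha.le hb.le hab
  have hsub : P ⊆ {x | φ v ≤ φ x ∧ (φ x = φ v → x ∈ segment ℝ v w)} := by
    rw [← hP.convexHull_extremePoints]
    refine convexHull_min (fun x hx => ⟨(hφ x hx).1, fun hxv => ?_⟩)
      hconv
    obtain ⟨t, ht, hxt⟩ := (hφ x hx).2 hxv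
    rw [segment_eq_image']
    refine ⟨t, ⟨ht, ?_⟩, by simp [← hxt]⟩
    -- Otherwise `w` lies strictly between the points `v` and `x` of `P`.
    by_contra! ht1
    have ht0 : 0 < t := one_pos.trans ht1
    refine hvw (hw.2 hv.1 hx.1 ?_)
    rw [openSegment_eq_image']
    refine ⟨t⁻¹, ⟨inv_pos.2 ht0, inv_lt_one_of_one_lt₀ ht1⟩, ?_⟩
    simp [hxt, ht0.ne']
  have hPconv : Convex ℝ P := hP.convexHull_extremePoints ▸ convex_convexHull ℝ _
  ext x
  constructor
  · intro hx
    refine ⟨hPconv.segment_subset hv.1 hw.1 hx, fun y hy => ?_⟩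
    obtain ⟨a, b, -, -, hab, rfl⟩ := hx
    have : φ (a • v + b • w) = φ v := by
      simp only [map_add, map_smul, smul_eq_mul, hφw]
      rw [← add_mul, hab, one_mul]
    simpa [this] using (hsub hy).1
  · rintro ⟨hxP, hx⟩
    exact (hsub hxP).2 (le_antisymm (by simpa using hx v hv.1) (hsub hxP).1)

/-- The vertex cone, although defined by the edges at `v`, is generated by all vertices: in a
minimal generating set of differences `w - v`, every element comes from an edge. -/
theorem span_edges_eq_span_vertices {P : Set (Fin d → ℝ)} (hP : IsPolytope P) {v : Fin d → ℝ}
    (hv : v ∈ P.extremePoints ℝ) :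
    Submodule.span NNReal {u : Fin d → ℝ | ∃ w, IsEdge P v w ∧ u = w - v} =
      Submodule.span NNReal ((fun w => w - v) '' P.extremePoints ℝ) := by
  refine le_antisymm (Submodule.span_mono ?_) ?_
  · rintro _ ⟨w, hw, rfl⟩
    exact ⟨w, hw.2.2.1, rfl⟩
  -- As `v` is a vertex, some functional is positive on all differences.
  obtain ⟨l, a, hla, hlV⟩ : ∃ (l : StrongDual ℝ (Fin d → ℝ)) (a : ℝ), l v < a ∧
      ∀ b ∈ convexHull ℝ (P.extremePoints ℝ \ {v}), a < l b := by
    refine geometric_hahn_banach_point_closed (convex_convexHull ℝ _)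
      (hP.finite_extremePoints.sdiff.isClosed_convexHull ℝ) fun hmem => ?_
    have hPconv : Convex ℝ P := hP.convexHull_extremePoints ▸ convex_convexHull ℝ _
    exact (hPconv.mem_extremePoints_iff_mem_sdiff_convexHull_sdiff.1 hv).2
      (convexHull_mono (Set.sdiff_subset_sdiff_left extremePoints_subset) hmem)
  have hl : ∀ w ∈ P.extremePoints ℝ, w ≠ v → 0 < l (w - v) := fun w hw hwv => by
    rw [map_sub, sub_pos]
    exact hla.trans (hlV w (subset_convexHull ℝ _ ⟨hw, hwv⟩))
  let D : Set (Fin d → ℝ) := (fun w => w - v) '' (P.extremePoints ℝ \ {v})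
  have hD : D.Finite := hP.finite_extremePoints.sdiff.image _
  have hspanD : Submodule.span NNReal ((fun w => w - v) '' P.extremePoints ℝ) ≤
      Submodule.span NNReal D := by
    refine Submodule.span_le.2 ?_
    rintro _ ⟨w, hw, rfl⟩
    by_cases hwv : w = v
    · simp [hwv]
    · exact Submodule.subset_span ⟨w, ⟨hw, hwv⟩, rfl⟩
  obtain ⟨G, hGmin⟩ : ∃ G, Minimal
      (fun G => G ∈ {G | G ⊆ D ∧ Submodule.span NNReal D ≤ Submodule.span NNReal G}) G :=
    (hD.finite_subsets.subset fun G hG => hG.1).exists_minimal ⟨D, subset_rfl, le_rfl⟩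
  obtain ⟨hGD, hDG⟩ := hGmin.prop
  refine (hspanD.trans hDG).trans (Submodule.span_mono fun g hg => ?_)
  obtain ⟨w, ⟨hw, hwv⟩, hwg⟩ := hGD hg
  have hins : insert g (G \ {g}) = G := Set.insert_sdiff_self_of_mem hg
  have hlD : ∀ x ∈ D, 0 < l x := by
    rintro _ ⟨x, ⟨hx, hxv⟩, rfl⟩
    exact hl x hx hxv
  have hgG : g ∉ Submodule.span NNReal (G \ {g}) := by
    intro hmem
    have := hGmin.le_of_le (y := G \ {g}) ⟨Set.sdiff_subset.trans hGD, hDG.trans ?_⟩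
      Set.sdiff_subset
    · exact (this hg).2 rfl
    · rw [← hins, Submodule.span_le, hins]
      intro x hx
      by_cases hxg : x = g
      · exact hxg ▸ hmem
      · exact Submodule.subset_span ⟨hx, hxg⟩
  obtain ⟨φ, hφg, hφpos⟩ := exists_dual_eq_zero_and_pos ((hD.subset hGD).sdiff (t := {g}))
    (fun x hx => hlD x (hGD hx.1)) (hlD g (hGD hg)) hgG
  have hwg' : w - v = g := hwg
  refine ⟨w, isEdge_of_dual hP hv hw (Ne.symm hwv) (φ := φ) ?_ fun x hx => ?_, hwg.symm⟩
  · rw [← sub_eq_zero, ← map_sub, hwg', hφg]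
  · have hxG : x - v ∈ Submodule.span NNReal (insert g (G \ {g})) :=
      hins.symm ▸ hDG (hspanD (Submodule.subset_span ⟨x, hx, rfl⟩))
    obtain ⟨t, y, hy, hxy⟩ := Submodule.mem_span_insert.1 hxG
    have hφy : 0 ≤ φ y ∧ (φ y = 0 → y = 0) :=
      nonneg_and_eq_zero_of_mem_span_nnreal (φ := φ.toLinearMap) hφpos hy
    have hφx : φ x - φ v = φ y := by
      rw [← map_sub, hxy, map_add, show t • g = (t : ℝ) • g from rfl, map_smul, hφg, smul_zero,
        zero_add]
    refine ⟨sub_nonneg.1 (hφx ▸ hφy.1), fun h => ⟨t, t.2, ?_⟩⟩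
    rw [hxy, hφy.2 (by rw [← hφx, h, sub_self]), add_zero, hwg']
    rfl

end Edges

/-! ### Affine combinations with sign conditions -/

section Combinations

variable {d : ℕ} {κ : Type*} [Fintype κ]

/-- The affine combinations of the points `p i` whose coefficients are non-negative on `I`. For
`I` everything this is the convex hull of the points, and if `I` omits only `i`, it is the cone
with apex `p i` generated by the differences to the other points. -/
def affineCombinations (p : κ → Fin d → ℝ) (I : Finset κ) : Set (Fin d → ℝ) :=
  {x | ∃ c : κ → ℝ, (∑ i, c i = 1 ∧ ∑ i, c i • p i = x) ∧ ∀ i ∈ I, 0 ≤ c i}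

/-- Vectors whose addition preserves `affineCombinations p I`: the combinations of the `p i` with
coefficient sum zero and coefficients non-negative on `I`. -/
def combinationDirections (p : κ → Fin d → ℝ) (I : Finset κ) : Submodule NNReal (Fin d → ℝ) where
  carrier := {x | ∃ c : κ → ℝ, ∑ i, c i = 0 ∧ ∑ i, c i • p i = x ∧ ∀ i ∈ I, 0 ≤ c i}
  add_mem' := by
    rintro _ _ ⟨b, hb, rfl, hbI⟩ ⟨c, hc, rfl, hcI⟩
    exact ⟨b + c, by simp [Finset.sum_add_distrib, hb, hc],
      by simp [Finset.sum_add_distrib, add_smul], fun i hi => add_nonneg (hbI i hi) (hcI i hi)⟩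
  zero_mem' := ⟨0, by simp⟩
  smul_mem' := by
    rintro a _ ⟨c, hc, rfl, hcI⟩
    refine ⟨fun i => a * c i, by rw [← Finset.mul_sum, hc, mul_zero], ?_,
      fun i hi => mul_nonneg a.2 (hcI i hi)⟩
    simp only [mul_smul, ← Finset.smul_sum]
    rfl

theorem add_mem_affineCombinations {p : κ → Fin d → ℝ} {I : Finset κ} {x y : Fin d → ℝ}
    (hx : x ∈ affineCombinations p I) (hy : y ∈ combinationDirections p I) :
    x + y ∈ affineCombinations p I := by
  obtain ⟨b, ⟨hb, rfl⟩, hbI⟩ := hx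
  obtain ⟨c, hc, rfl, hcI⟩ := hy
  exact ⟨b + c, ⟨by simp [Finset.sum_add_distrib, hb, hc],
    by simp [Finset.sum_add_distrib, add_smul]⟩, fun i hi => add_nonneg (hbI i hi) (hcI i hi)⟩

theorem sub_mem_combinationDirections (p : κ → Fin d → ℝ) {I : Finset κ} {i : κ} (hi : i ∉ I)
    (j : κ) : p j - p i ∈ combinationDirections p I := by
  classical
  refine ⟨Pi.single j 1 - Pi.single i 1, by simp, ?_, fun k hk => ?_⟩
  · simp [sub_smul, Pi.single_apply, ite_smul]
  · have hki : k ≠ i := fun h => hi (h ▸ hk)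
    by_cases hkj : k = j
    · subst hkj; simp [hki]
    · simp [hki, hkj]

open Classical in
/-- The sets `affineCombinations p I` are cut out by half-spaces of the affine hyperplane
`∑ c i = 1`, in which some coefficient of every point is positive. Hence their indicator functions
satisfy the inclusion-exclusion relation. -/
theorem sum_neg_one_pow_card_affineCombinations (p : κ → Fin d → ℝ) (x : Fin d → ℝ) :
    ∑ I : Finset κ, (if x ∈ affineCombinations p I then (-1 : ℂ) ^ I.card else 0) = 0 := by
  let σ : (κ → ℝ) →ₗ[ℝ] ℝ := ∑ i, LinearMap.proj (R := ℝ) (φ := fun _ : κ => ℝ) i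
  let L : (κ → ℝ) →ₗ[ℝ] Fin d → ℝ :=
    ∑ i, (LinearMap.proj (R := ℝ) (φ := fun _ : κ => ℝ) i).smulRight (p i)
  have hσ : ∀ c, σ c = ∑ i, c i := fun c => by simp [σ]
  have hL : ∀ c, L c = ∑ i, c i • p i := fun c => by simp [L]
  have hclosed : IsClosed (σ ⁻¹' {1} ∩ L ⁻¹' {x}) :=
    (isClosed_singleton.preimage σ.continuous_of_finiteDimensional).inter
      (isClosed_singleton.preimage L.continuous_of_finiteDimensional)
  have hconv : Convex ℝ (σ ⁻¹' {1} ∩ L ⁻¹' {x}) :=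
    ((convex_singleton _).linear_preimage σ).inter ((convex_singleton _).linear_preimage L)
  have := sum_neg_one_pow_card_ite_exists_eq_zero hclosed hconv (fun _ => 0) ?_
  · refine Eq.trans (Finset.sum_congr rfl fun I _ => if_congr ?_ rfl rfl) this
    simp only [affineCombinations, Set.mem_inter_iff, Set.mem_preimage, Set.mem_singleton_iff,
      hσ, hL, Set.mem_ofPred_eq]
  · rintro ⟨c, ⟨hc, -⟩, hneg⟩
    have hc1 : ∑ i, c i = 1 := (hσ c).symm.trans hc
    have : ∑ i, c i ≤ 0 := Finset.sum_nonpos fun i _ => (hneg i).le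
    linarith

theorem affineCombinations_univ (p : κ → Fin d → ℝ) :
    affineCombinations p Finset.univ = convexHull ℝ (Set.range p) := by
  refine Set.Subset.antisymm ?_ (convexHull_min ?_ ?_)
  · rintro _ ⟨c, ⟨hc, rfl⟩, hpos⟩
    exact (convex_convexHull ℝ _).sum_mem hpos hc
      fun i _ => subset_convexHull ℝ _ (Set.mem_range_self i)
  · rintro _ ⟨i, rfl⟩
    classical
    refine ⟨Pi.single i 1, ⟨by simp, by simp [Pi.single_apply, ite_smul]⟩, fun j _ => ?_⟩
    by_cases hj : j = i
    · subst hj; simp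
    · simp [hj]
  · rintro _ ⟨b, ⟨hb, rfl⟩, hbI⟩ _ ⟨c, ⟨hc, rfl⟩, hcI⟩ s t hs ht hst
    refine ⟨fun i => s * b i + t * c i, ⟨?_, ?_⟩, fun i hi =>
      add_nonneg (mul_nonneg hs (hbI i hi)) (mul_nonneg ht (hcI i hi))⟩
    · rw [Finset.sum_add_distrib, ← Finset.mul_sum, ← Finset.mul_sum, hb, hc, mul_one, mul_one,
        hst]
    · simp only [add_smul, mul_smul, Finset.sum_add_distrib, ← Finset.smul_sum]

theorem affineCombinations_erase [DecidableEq κ] (p : κ → Fin d → ℝ) (i : κ) :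
    affineCombinations p (Finset.univ.erase i) =
      {x | x - p i ∈ Submodule.span NNReal (Set.range fun j => p j - p i)} := by
  ext x
  constructor
  · rintro ⟨c, ⟨hc, rfl⟩, hpos⟩
    have hsub : ∑ j, c j • p j - p i = ∑ j, c j • (p j - p i) := by
      simp only [smul_sub, Finset.sum_sub_distrib, ← Finset.sum_smul, hc, one_smul]
    simp only [Set.mem_ofPred_eq, hsub]
    refine sum_mem fun j _ => ?_
    by_cases hj : j = i
    · simp [hj]
    · exact Submodule.smul_mem _ (⟨c j, hpos j (by simp [hj])⟩ : NNReal)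
        (Submodule.subset_span ⟨j, rfl⟩)
  · intro hx
    have hle : Submodule.span NNReal (Set.range fun j => p j - p i) ≤
        combinationDirections p (Finset.univ.erase i) := by
      refine Submodule.span_le.2 ?_
      rintro _ ⟨j, rfl⟩
      exact sub_mem_combinationDirections p (Finset.notMem_erase i _) j
    have hpi : p i ∈ affineCombinations p (Finset.univ.erase i) :=
      ⟨Pi.single i 1, ⟨by simp, by simp [Pi.single_apply, ite_smul]⟩, fun j hj => by
        simp [Finset.ne_of_mem_erase hj]⟩
    simpa using add_mem_affineCombinations hpi (hle hx)

end Combinations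

/-- If a cone lies in a larger cone `D` that contains the opposite of one of its non-zero elements,
then `D` contains the opposite of one of its non-zero generators. -/
theorem exists_generator_neg_mem {E : Type*} [AddCommGroup E] [Module ℝ E] {G : Set E}
    {D : Submodule NNReal E} (hG : G ⊆ D) {y : E} (hy : y ∈ Submodule.span NNReal G)
    (hy0 : y ≠ 0) (hyD : -y ∈ D) : ∃ u ∈ G, u ≠ 0 ∧ -u ∈ D := by
  have hGD : Submodule.span NNReal G ≤ D := Submodule.span_le.2 hG
  induction hy using Submodule.span_induction with
  | mem u hu => exact ⟨u, hu, hy0, hyD⟩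
  | zero => exact absurd rfl hy0
  | add x y hx hy ihx ihy =>
    by_cases hx0 : x = 0
    · subst hx0
      exact ihy (by simpa using hy0) (by simpa using hyD)
    · refine ihx hx0 ?_
      have := add_mem hyD (hGD hy)
      simpa using this
  | smul a x hx ih =>
    have ha : a ≠ 0 := by
      rintro rfl
      simp at hy0
    refine ih (by rintro rfl; simp at hy0) ?_
    have := Submodule.smul_mem D a⁻¹ hyD
    rwa [← smul_neg, inv_smul_smul₀ ha] at this

/-! ### Brion's formula -/

section Brion

variable {d : ℕ} {P : Set (Fin d → ℝ)}

/-- If two vertices `v` and `w` carry no sign condition, the set contains the line direction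
`w - v`. This direction need not be rational, but it lies in the cone of the edges at `v`, so the
direction of one of these edges is a line direction as well. -/
theorem generatingSeries_affineCombinations_represents_zero (hP : IsPolytope P)
    (hrat : ∀ v w, IsEdge P v w → HasRationalDirection (w - v)) {I : Finset hP.vertices}
    {v w : hP.vertices} (hv : v ∉ I) (hw : w ∉ I) (hvw : v ≠ w) :
    (generatingSeries (affineCombinations (Subtype.val : hP.vertices → Fin d → ℝ) I)).Represents
      0 := by
  let D := combinationDirections (Subtype.val : hP.vertices → Fin d → ℝ) I
  have hmem : ∀ x : hP.vertices, x.1 ∈ P.extremePoints ℝ := fun x =>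
    hP.finite_extremePoints.mem_toFinset.1 x.2
  have hG : {u : Fin d → ℝ | ∃ w, IsEdge P v w ∧ u = w - v} ⊆ D := by
    rintro _ ⟨x, hx, rfl⟩
    exact sub_mem_combinationDirections (Subtype.val : hP.vertices → Fin d → ℝ) hv
      ⟨x, hP.finite_extremePoints.mem_toFinset.2 hx.2.2.1⟩
  have hy : w.1 - v.1 ∈ Submodule.span NNReal {u : Fin d → ℝ | ∃ w, IsEdge P v w ∧ u = w - v} := by
    rw [span_edges_eq_span_vertices hP (hmem v)]
    exact Submodule.subset_span ⟨w, hmem w, rfl⟩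
  obtain ⟨u, ⟨x, hx, rfl⟩, hu0, huD⟩ := exists_generator_neg_mem hG hy
    (sub_ne_zero.2 fun h => hvw (Subtype.ext h.symm))
    (by rw [neg_sub]; exact sub_mem_combinationDirections _ hw v)
  have huD' : x - v.1 ∈ D := hG ⟨x, hx, rfl⟩
  obtain ⟨z, c, hz, hc, hu⟩ := (hrat v x hx).exists_pos_smul hu0
  have hzD : (fun i => (z i : ℝ)) ∈ D := by
    have := Submodule.smul_mem D c⁻¹ huD'
    rwa [hu, inv_smul_smul₀ hc] at this
  have hzD' : -(fun i => (z i : ℝ)) ∈ D := by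
    have := Submodule.smul_mem D c⁻¹ huD
    rwa [hu, ← smul_neg, inv_smul_smul₀ hc] at this
  refine represents_zero_of_invariant hz fun m => ?_
  have hcast : (fun i => ((m - z) i : ℝ)) = (fun i => (m i : ℝ)) + -(fun i => (z i : ℝ)) := by
    ext i
    simp [sub_eq_add_neg]
  have hiff : m - z ∈ integerPoints (affineCombinations Subtype.val I) ↔
      m ∈ integerPoints (affineCombinations (Subtype.val : hP.vertices → Fin d → ℝ) I) := by
    simp only [integerPoints, Set.mem_ofPred_eq, hcast]
    refine ⟨fun h => ?_, fun h => add_mem_affineCombinations h hzD'⟩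
    simpa using add_mem_affineCombinations h hzD
  classical exact if_congr hiff rfl rfl

theorem affineCombinations_vertices_erase (hP : IsPolytope P) [DecidableEq hP.vertices]
    (v : hP.vertices) :
    affineCombinations (Subtype.val : hP.vertices → Fin d → ℝ) (Finset.univ.erase v) =
      vertexCone P v := by
  have hv : v.1 ∈ P.extremePoints ℝ := hP.finite_extremePoints.mem_toFinset.1 v.2
  have hrange : Set.range (fun w : hP.vertices => w.1 - v.1) =
      (fun w => w - v.1) '' P.extremePoints ℝ := by
    ext u
    simp [IsPolytope.vertices]
  rw [affineCombinations_erase, vertexCone, span_edges_eq_span_vertices hP hv, hrange]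

theorem affineCombinations_vertices_univ (hP : IsPolytope P) :
    affineCombinations (Subtype.val : hP.vertices → Fin d → ℝ) Finset.univ = P := by
  have hrange : Set.range (Subtype.val : hP.vertices → Fin d → ℝ) = P.extremePoints ℝ := by
    ext u
    simp [IsPolytope.vertices]
  rw [affineCombinations_univ, hrange, hP.convexHull_extremePoints]

/-- The inclusion-exclusion relation between the sets `affineCombinations`, read off for the
rational functions that they represent. Only the full set `I`, giving `P`, and the sets `I` that
omit a single vertex, giving the vertex cones, contribute. -/
theorem generatingPolynomial_eq_sum (hP : IsPolytope P)
    (hrat : ∀ v w, IsEdge P v w → HasRationalDirection (w - v)) :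
    algebraMap (LaurentPoly d) (RatFun d) hP.generatingPolynomial =
      ∑ v ∈ hP.vertices, rationalGeneratingFunction (vertexCone P v) := by
  classical
  let p : hP.vertices → Fin d → ℝ := Subtype.val
  let S : Finset hP.vertices → FormalLaurentSeries d := fun I =>
    generatingSeries (affineCombinations p I)
  have huniv : (S Finset.univ).Represents (algebraMap _ (RatFun d) hP.generatingPolynomial) := by
    simp only [S, p, affineCombinations_vertices_univ hP, ← hP.toSeries_generatingPolynomial]
    exact represents_toSeries _
  have herase : ∀ v, (S (Finset.univ.erase v)).Represents
      (rationalGeneratingFunction (vertexCone P v)) := fun v => by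
    simp only [S, p, affineCombinations_vertices_erase hP]
    exact generatingSeries_represents_rationalGeneratingFunction
      (exists_generatingSeries_vertexCone_represents hP (hrat v))
  have hother : ∀ I, I ≠ Finset.univ → (∀ v, I ≠ Finset.univ.erase v) → (S I).Represents 0 := by
    intro I hI hIv
    obtain ⟨v, hv⟩ : ∃ v, v ∉ I := by
      by_contra! h
      exact hI (Finset.eq_univ_iff_forall.2 h)
    obtain ⟨w, hwv, hw⟩ : ∃ w, w ≠ v ∧ w ∉ I := by
      by_contra! h
      refine hIv v (Finset.ext fun w => ?_)
      by_cases hwv : w = v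
      · simp [hwv, hv]
      · simp [hwv, h w hwv]
    exact generatingSeries_affineCombinations_represents_zero hP hrat hv hw hwv.symm
  have hex : ∀ I, ∃ r, (S I).Represents r := by
    intro I
    by_cases hI : I = Finset.univ
    · exact ⟨_, hI ▸ huniv⟩
    · by_cases hIv : ∃ v, I = Finset.univ.erase v
      · obtain ⟨v, rfl⟩ := hIv
        exact ⟨_, herase v⟩
      · exact ⟨_, hother I hI (not_exists.1 hIv)⟩
  choose r hr using hex
  have hsum : ∑ I, (-1 : RatFun d) ^ I.card * r I = 0 := by
    have h := represents_sum Finset.univ fun I _ => represents_neg_one_pow_smul (hr I) I.card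
    have hS : ∑ I, (-1 : ℂ) ^ I.card • S I = 0 := by
      ext m
      rw [Finset.sum_apply]
      refine Eq.trans (Finset.sum_congr rfl fun I _ => ?_)
        (sum_neg_one_pow_card_affineCombinations p fun i => (m i : ℝ))
      exact mul_boole _ _
    rw [hS] at h
    exact h.unique represents_zero
  have hinj : Function.Injective fun v : hP.vertices => Finset.univ.erase v := fun v w h =>
    Finset.erase_injOn _ (Finset.mem_coe.2 (Finset.mem_univ v))
      (Finset.mem_coe.2 (Finset.mem_univ w)) h
  have hnotMem : (Finset.univ : Finset hP.vertices) ∉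
      Finset.univ.image fun v : hP.vertices => Finset.univ.erase v := by
    simp only [Finset.mem_image, Finset.mem_univ, true_and, not_exists]
    exact fun v h => Finset.notMem_erase v Finset.univ (by rw [h]; exact Finset.mem_univ v)
  rw [← Finset.sum_subset (Finset.subset_univ
      (insert Finset.univ (Finset.univ.image fun v : hP.vertices => Finset.univ.erase v)))
      fun I _ hI => ?_, Finset.sum_insert hnotMem, Finset.sum_image hinj.injOn] at hsum
  · rw [← Finset.sum_coe_sort hP.vertices]
    have hcard : ∀ v : hP.vertices, (-1 : RatFun d) ^ (Finset.univ.erase v).card *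
        r (Finset.univ.erase v) = -((-1) ^ (Finset.univ : Finset hP.vertices).card *
        rationalGeneratingFunction (vertexCone P v)) := by
      intro v
      rw [(hr _).unique (herase v), ← Finset.card_erase_add_one (Finset.mem_univ v), pow_succ]
      ring
    simp only [hcard, Finset.sum_neg_distrib, ← Finset.mul_sum, ← sub_eq_add_neg] at hsum
    rw [(hr _).unique huniv, ← mul_sub] at hsum
    exact sub_eq_zero.1 ((mul_eq_zero.1 hsum).resolve_left (pow_ne_zero _ (by simp)))
  · simp only [Finset.mem_insert, Finset.mem_image, Finset.mem_univ, true_and, not_or,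
      not_exists] at hI
    rw [(hr I).unique (hother I hI.1 fun v h => hI.2 v h.symm), mul_zero]

end Brion

/-- Brion's formula. -/
theorem mainTheorem1 (d : ℕ) (P : Set (Fin d → ℝ)) (hP : IsPolytope P)
    (hrat : ∀ v w, IsEdge P v w → HasRationalDirection (w - v)) :
    (∀ v ∈ hP.vertices, ∃! r : RatFun d, (generatingSeries (vertexCone P v)).Represents r) ∧
      algebraMap (LaurentPoly d) (RatFun d) hP.generatingPolynomial =
        ∑ v ∈ hP.vertices, rationalGeneratingFunction (vertexCone P v) := by
  refine ⟨fun v _ => ?_, generatingPolynomial_eq_sum hP hrat⟩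
  obtain ⟨r, hr⟩ := exists_generatingSeries_vertexCone_represents hP (hrat v)
  exact ⟨r, hr, fun r' hr' => hr'.unique hr⟩
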